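/- Let $q\ge 1$ be an integer and let $\Gamma$ be the group with generators $x_1,\dots,x_{4q}$ and the $4q^2$ relations $$x_{1+4i}\,x_{2+4j}\,x_{4+4i}\,x_{3+4j}=1,\qquad x_{1+4i}\,x_{1+4j}\,x_{4+4i}\,x_{4+4j}=1,$$ $$x_{1+4i}\,x_{3+4j}\,x_{4+4i}\,x_{2+4j}=1,\qquad x_{2+4i}\,x_{2+4j}\,x_{3+4i}\,x_{3+4j}=1,$$ for $i,j=0,1,\dots,q-1$. Then $\Gamma$ contains a subgroup $\Gamma_0$ of index four that is of Burger–Mozes type, acting on a product of two trees of valence $2(4q-1)$. That is, there are trees $\mathcal T_1,\mathcal T_2$, all of whose vertices have valence $2(4q-1)$, such that $\Gamma_0$ is isomorphic to a discrete torsion-free subgroup of $\mathrm{Aut}(\mathcal T_1)\times\mathrm{Aut}(\mathcal T_2)$ acting freely and transitively on the set of vertices of $\mathcal T_1\times\mathcal T_2$. Here $\mathrm{Aut}(\mathcal T_i)$ carries the topology of pointwise convergence on the (discrete) set of vertices. -/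

import Mathlib

namespace SquareGroup

/-- The letter `x_k`, for `1 ≤ k ≤ 4q`, in the free group on `x_1, …, x_{4q}`. -/
def x {q : ℕ} (k : ℕ) (hk : k ∈ Set.Icc 1 (4 * q) := by constructor <;> omega) :
    FreeGroup (Set.Icc 1 (4 * q)) :=
  FreeGroup.of ⟨k, hk⟩

/-- The `4q²` defining relators, indexed by `i, j = 0, …, q - 1`. -/
def relators (q : ℕ) : Set (FreeGroup (Set.Icc 1 (4 * q))) :=
  {w | ∃ i j : Fin q,
    w = x (1 + 4 * i) * x (2 + 4 * j) * x (4 + 4 * i) * x (3 + 4 * j) ∨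
    w = x (1 + 4 * i) * x (1 + 4 * j) * x (4 + 4 * i) * x (4 + 4 * j) ∨
    w = x (1 + 4 * i) * x (3 + 4 * j) * x (4 + 4 * i) * x (2 + 4 * j) ∨
    w = x (2 + 4 * i) * x (2 + 4 * j) * x (3 + 4 * i) * x (3 + 4 * j)}

/-- The group `Γ` with generators `x_1, …, x_{4q}` and the relations above. -/
abbrev Gamma (q : ℕ) : Type := PresentedGroup (relators q)

end SquareGroup

namespace BurgerMozes

/-- The topology of pointwise convergence on the vertices (the vertex set being discrete) on the
automorphism group of a graph. -/
instance autTopology {V : Type*} (T : SimpleGraph V) : TopologicalSpace (T ≃g T) :=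
  TopologicalSpace.induced (fun (g : T ≃g T) (v : V) => g v)
    (@Pi.topologicalSpace V (fun _ => V) (fun _ => ⊥))

/-- `T` is a tree all of whose vertices have valence `d`. -/
def IsTreeOfValence {V : Type*} (T : SimpleGraph V) (d : ℕ) : Prop :=
  T.IsTree ∧ ∃ _ : T.LocallyFinite, T.IsRegularOfDegree d

/-- A subgroup of `Aut T₁ × Aut T₂` is a Burger–Mozes group if it is discrete, torsion free, and
acts freely and transitively on the vertex set `V₁ × V₂` of the product `T₁ × T₂`. -/
structure IsBMGroup {V₁ V₂ : Type*} {T₁ : SimpleGraph V₁} {T₂ : SimpleGraph V₂}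
    (Λ : Subgroup ((T₁ ≃g T₁) × (T₂ ≃g T₂))) : Prop where
  discrete : DiscreteTopology Λ
  torsionFree : ∀ g : Λ, IsOfFinOrder g → g = 1
  free : ∀ g ∈ Λ, ∀ (v : V₁) (w : V₂), g.1 v = v → g.2 w = w → g = 1
  transitive : ∀ (v v' : V₁) (w w' : V₂), ∃ g ∈ Λ, g.1 v = v' ∧ g.2 w = w'

/-- `G` is of Burger–Mozes type, acting on a product of two trees of valences `d₁` and `d₂`: it is
isomorphic to a Burger–Mozes group in `Aut T₁ × Aut T₂`, for such trees `T₁` and `T₂`. -/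
def IsOfBMType (G : Type*) [Group G] (d₁ d₂ : ℕ) : Prop :=
  ∃ (V₁ V₂ : Type) (T₁ : SimpleGraph V₁) (T₂ : SimpleGraph V₂),
    IsTreeOfValence T₁ d₁ ∧ IsTreeOfValence T₂ d₂ ∧
    ∃ Λ : Subgroup ((T₁ ≃g T₁) × (T₂ ≃g T₂)), IsBMGroup Λ ∧ Nonempty (G ≃* Λ)

end BurgerMozes

/-! Up to cyclic rotation the relators say `y a * y b * y ā * y b̄ = 1` for all letters, where `a ↦
ā` is the involution `opposite`. So Γ maps onto ℤ/4 with every letter of degree 1, and `Γ₀` is the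
kernel. Fix a letter `o`. The elements `y a * (y o)⁻¹` and their conjugates by `y o` commute with
each other (`commute_mul_inv`) and generate the kernel (`range_prodHom_eq_ker`), so the kernel is a
quotient of F × F with F free of rank 4q - 1. No further relation holds: Γ acts on W × W, with W a
free product of groups of order two, by twisted swaps, and under this action F × F translates the
two coordinates separately and faithfully (`prodHom_injective`). Finally F × F acts simply
transitively on the vertices of the product of two Cayley trees of F, of valence 2(4q - 1). -/

/-! ### The Cayley tree of a free group. -/

namespace FreeGroup

variable {α : Type*}

/-- The Cayley graph of the free group on `α`, in which `g` is joined to `s * g` for every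
letter `s`. -/
def cayleyTree (α : Type*) : SimpleGraph (FreeGroup α) where
  Adj g h := ∃ s : α × Bool, h = mk [s] * g
  symm := ⟨by
    rintro g _ ⟨⟨a, b⟩, rfl⟩
    refine ⟨(a, !b), ?_⟩
    have : (mk [(a, !b)] : FreeGroup α) = (mk [(a, b)])⁻¹ := by simp [inv_mk, invRev]
    rw [this, inv_mul_cancel_left]⟩
  loopless := ⟨by
    classical
    rintro g ⟨s, hs⟩
    have h : mk [s] = 1 := right_eq_mul.1 hs
    simpa using congrArg toWord h⟩

theorem cayleyTree_adj {g h : FreeGroup α} :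
    (cayleyTree α).Adj g h ↔ ∃ s : α × Bool, h = mk [s] * g := Iff.rfl

theorem mk_singleton_injective : Function.Injective fun s : α × Bool => mk [s] := by
  classical
  intro s t h
  simpa using congrArg toWord h

theorem cayleyTree_connected : (cayleyTree α).Connected := by
  have key : ∀ L : List (α × Bool), (cayleyTree α).Reachable 1 (mk L) := by
    intro L
    induction L with
    | nil => exact SimpleGraph.Reachable.refl _
    | cons s L ih =>
      exact ih.trans (SimpleGraph.Adj.reachable ⟨s, by rw [mul_mk]; rfl⟩)
  have hone : ∀ g, (cayleyTree α).Reachable 1 g := by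
    rintro ⟨L⟩
    exact key L
  exact ⟨fun g h => (hone g).symm.trans (hone h)⟩

/-- A neighbour of `g` whose norm does not exceed that of `g` is obtained by deleting the first
letter of the reduced word of `g`. -/
theorem toWord_tail_of_adj_of_norm_le [DecidableEq α] {g h : FreeGroup α}
    (hadj : (cayleyTree α).Adj g h) (hle : h.norm ≤ g.norm) : h.toWord = g.toWord.tail := by
  obtain ⟨s, rfl⟩ := hadj
  have hw : (mk [s] * g).toWord = reduce (s :: g.toWord) := by
    conv_lhs => rw [← mk_toWord (x := g), mul_mk, toWord_mk]
    rfl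
  have hle' : (mk [s] * g).toWord.length ≤ g.toWord.length := hle
  rw [hw, reduce.cons, reduce_toWord] at hle' ⊢
  cases hg : g.toWord with
  | nil => simp [hg] at hle'
  | cons t L =>
    simp only [hg] at hle' ⊢
    split_ifs at hle' ⊢ with h
    · rfl
    · simp at hle'

/-- At a vertex of maximal norm on a cycle, both neighbours along the cycle have reduced word the
tail of that vertex's word, so they coincide, which a cycle forbids. -/
theorem cayleyTree_isAcyclic : (cayleyTree α).IsAcyclic := by
  classical
  intro v c hc
  obtain ⟨u, hu, hmax⟩ := c.support.toFinset.exists_max_image norm ⟨v, by simp⟩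
  rw [List.mem_toFinset] at hu
  have hc' := hc.rotate hu
  have hmem : ∀ w ∈ (c.rotate u hu).support, w.norm ≤ u.norm := by
    intro w hw
    exact hmax w (by simpa using hw)
  apply hc'.snd_ne_penultimate
  apply toWord_injective
  rw [toWord_tail_of_adj_of_norm_le ((c.rotate u hu).adj_snd hc'.not_nil)
      (hmem _ (SimpleGraph.Walk.getVert_mem_support _ _)),
    toWord_tail_of_adj_of_norm_le ((c.rotate u hu).adj_penultimate hc'.not_nil).symm
      (hmem _ (SimpleGraph.Walk.getVert_mem_support _ _))]

/-- The letters index the neighbours of a vertex of the Cayley tree. -/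
noncomputable def neighborSetEquiv (g : FreeGroup α) :
    α × Bool ≃ (cayleyTree α).neighborSet g :=
  Equiv.ofBijective (fun s => ⟨mk [s] * g, s, rfl⟩) ⟨fun _ _ h =>
    mk_singleton_injective (mul_right_cancel (congrArg Subtype.val h)),
    fun ⟨_, s, hs⟩ => ⟨s, Subtype.ext hs.symm⟩⟩

theorem isTreeOfValence_cayleyTree [Fintype α] :
    BurgerMozes.IsTreeOfValence (cayleyTree α) (2 * Fintype.card α) := by
  refine ⟨⟨cayleyTree_connected, cayleyTree_isAcyclic⟩,
    fun g => Fintype.ofEquiv _ (neighborSetEquiv g), fun g => ?_⟩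
  rw [← SimpleGraph.card_neighborSet_eq_degree, Fintype.ofEquiv_card, Fintype.card_prod,
    Fintype.card_bool, mul_comm]

/-- The free group acts on its Cayley tree by `g • u = u * g⁻¹`. -/
def cayleyTreeAction (α : Type*) : FreeGroup α →* (cayleyTree α ≃g cayleyTree α) where
  toFun g :=
    { Equiv.mulRight g⁻¹ with
      map_rel_iff' := by
        intro u v
        simp [cayleyTree_adj, ← mul_assoc] }
  map_one' := by ext u; simp
  map_mul' g h := by ext u; simp [mul_assoc]

end FreeGroup

/-! ### Free actions on products of trees. -/

namespace BurgerMozes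

variable {V V₁ V₂ : Type*}

theorem isOpen_setOf_apply_eq (T : SimpleGraph V) (v w : V) :
    IsOpen {g : T ≃g T | g v = w} := by
  let _ : TopologicalSpace V := ⊥
  have : DiscreteTopology V := ⟨rfl⟩
  have hc : Continuous fun g : T ≃g T => fun u : V => g u := continuous_induced_dom
  exact (isOpen_discrete {w}).preimage ((continuous_apply v).comp hc)

/-- A subgroup of `Aut T₁ × Aut T₂` that acts freely on the vertices is discrete. -/
theorem discreteTopology_of_free [Nonempty V₁] [Nonempty V₂] {T₁ : SimpleGraph V₁}
    {T₂ : SimpleGraph V₂} (Λ : Subgroup ((T₁ ≃g T₁) × (T₂ ≃g T₂)))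
    (hfree : ∀ g ∈ Λ, ∀ (v : V₁) (w : V₂), g.1 v = v → g.2 w = w → g = 1) :
    DiscreteTopology Λ := by
  obtain ⟨v⟩ := ‹Nonempty V₁›
  obtain ⟨w⟩ := ‹Nonempty V₂›
  refine discreteTopology_iff_isOpen_singleton.2 fun g => ?_
  -- Agreeing with `g` at the single vertex `(v, w)` is an open condition, and freeness leaves only
  -- `g` itself.
  have hopen : IsOpen {h : Λ | h.1.1 v = g.1.1 v ∧ h.1.2 w = g.1.2 w} :=
    (((isOpen_setOf_apply_eq T₁ v (g.1.1 v)).preimage continuous_fst).inter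
      ((isOpen_setOf_apply_eq T₂ w (g.1.2 w)).preimage continuous_snd)).preimage
      continuous_subtype_val
  convert hopen using 1
  ext h
  refine ⟨fun hh => by rw [Set.mem_singleton_iff.1 hh]; exact ⟨rfl, rfl⟩, fun ⟨h₁, h₂⟩ => ?_⟩
  have := hfree (g⁻¹ * h).1 (g⁻¹ * h).2 v w (by
    change g.1.1.symm (h.1.1 v) = v
    rw [h₁]; exact g.1.1.symm_apply_apply v) (by
    change g.1.2.symm (h.1.2 w) = w
    rw [h₂]; exact g.1.2.symm_apply_apply w)
  exact (inv_mul_eq_one.1 (Subtype.ext this : g⁻¹ * h = 1)).symm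

/-- A product of two free groups of finite rank is of Burger–Mozes type. -/
theorem isOfBMType_of_mulEquiv {α : Type} [Fintype α] {G : Type*} [Group G]
    (e : G ≃* FreeGroup α × FreeGroup α) :
    IsOfBMType G (2 * Fintype.card α) (2 * Fintype.card α) := by
  let f := (FreeGroup.cayleyTreeAction α).prodMap (FreeGroup.cayleyTreeAction α)
  have hf : ∀ (g : FreeGroup α × FreeGroup α) v w, (f g).1 v = v → (f g).2 w = w → g = 1 := by
    intro g v w h₁ h₂
    exact Prod.ext (inv_eq_one.1 (mul_eq_left.1 h₁)) (inv_eq_one.1 (mul_eq_left.1 h₂))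
  have hinj : Function.Injective f := (injective_iff_map_eq_one f).2 fun g hg =>
    hf g 1 1 (by rw [hg]; rfl) (by rw [hg]; rfl)
  have hfree : ∀ g ∈ f.range, ∀ v w, g.1 v = v → g.2 w = w → g = 1 := by
    rintro _ ⟨g, rfl⟩ v w h₁ h₂
    rw [hf g v w h₁ h₂, map_one]
  refine ⟨_, _, _, _, FreeGroup.isTreeOfValence_cayleyTree, FreeGroup.isTreeOfValence_cayleyTree,
    f.range, ⟨discreteTopology_of_free _ hfree, fun g hg => ?_, hfree, fun v v' w w' => ?_⟩,
    ⟨e.trans (MonoidHom.ofInjective hinj)⟩⟩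
  · obtain ⟨_, p, rfl⟩ := g
    obtain ⟨n, hn, hpn⟩ := isOfFinOrder_iff_pow_eq_one.1 hg
    have hp : p ^ n = 1 := hinj <| by
      rw [map_pow, map_one]
      exact congrArg Subtype.val hpn
    -- Free groups are torsion free.
    have h₁ : p.1 = 1 := (pow_eq_one_iff_left hn.ne').1 (congrArg Prod.fst hp)
    have h₂ : p.2 = 1 := (pow_eq_one_iff_left hn.ne').1 (congrArg Prod.snd hp)
    refine Subtype.ext ?_
    change f p = 1
    rw [show p = 1 from Prod.ext h₁ h₂, map_one]
  · refine ⟨f (v'⁻¹ * v, w'⁻¹ * w), ⟨_, rfl⟩, ?_, ?_⟩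
    · change v * (v'⁻¹ * v)⁻¹ = v'
      group
    · change w * (w'⁻¹ * w)⁻¹ = w'
      group

end BurgerMozes

/-! ### Free products of groups of order two. -/

/-- The free product of copies of the group of order two, one for each element of `A`. -/
abbrev FreeInvolutions (A : Type*) : Type _ :=
  PresentedGroup (Set.range fun a : A => FreeGroup.of a * FreeGroup.of a)

namespace FreeInvolutions

variable {A G : Type*} [Group G]

/-- The generating involution indexed by `a`. -/
def of (a : A) : FreeInvolutions A := PresentedGroup.of a

theorem of_mul_self (a : A) : of a * of a = 1 :=
  PresentedGroup.one_of_mem ⟨a, rfl⟩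

theorem of_mul_cancel_left (a : A) (u : FreeInvolutions A) : of a * (of a * u) = u := by
  rw [← mul_assoc, of_mul_self, one_mul]

/-- A family of elements of square one extends to a homomorphism. -/
def lift (f : A → G) (hf : ∀ a, f a * f a = 1) : FreeInvolutions A →* G :=
  PresentedGroup.toGroup (f := f) (by rintro _ ⟨a, rfl⟩; simpa using hf a)

@[simp]
theorem lift_of (f : A → G) (hf : ∀ a, f a * f a = 1) (a : A) : lift f hf (of a) = f a :=
  PresentedGroup.toGroup.of _

/-- The endomorphism induced by a map of the index set. -/
def map (s : A → A) : FreeInvolutions A →* FreeInvolutions A :=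
  lift (fun a => of (s a)) fun a => of_mul_self (s a)

@[simp]
theorem map_of (s : A → A) (a : A) : map s (of a) = of (s a) := lift_of _ _ a

theorem map_map {s : A → A} (hs : Function.Involutive s) (u : FreeInvolutions A) :
    map s (map s u) = u := by
  have : (map s).comp (map s) = MonoidHom.id _ :=
    PresentedGroup.ext fun a => by
      change map s (map s (of a)) = of a
      simp [hs a]
  exact DFunLike.congr_fun this u

/-- The homomorphism from a free group that sends the generator `a ≠ o` to `of a * of o`. -/
def evenHom (o : A) : FreeGroup {a // a ≠ o} →* FreeInvolutions A :=
  FreeGroup.lift fun a => of a.1 * of o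

-- Let `t` invert the generators of the free group. Since `t (e a) = (e a)⁻¹`, each `u ↦ e a * t u`
-- is an involution, which gives an action of `FreeInvolutions A`. As `e o = 1`, the product `of a *
-- of o` acts as left translation by the generator `a`, so the action restricts to the faithful
-- regular one.
open scoped Classical in
theorem evenHom_injective (o : A) : Function.Injective (evenHom o) := by
  let t : FreeGroup {a // a ≠ o} →* FreeGroup {a // a ≠ o} := FreeGroup.lift fun a => (FreeGroup.of a)⁻¹
  have ht : ∀ u, t (t u) = u := by
    have : t.comp t = MonoidHom.id _ := by ext a; simp [t]
    exact DFunLike.congr_fun this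
  let e : A → FreeGroup {a // a ≠ o} := fun a => if h : a = o then 1 else FreeGroup.of ⟨a, h⟩
  have hte : ∀ a, t (e a) = (e a)⁻¹ := by
    intro a
    by_cases h : a = o <;> simp [e, h, t]
  have hinv : ∀ a, Function.Involutive fun u => e a * t u := by
    intro a u
    simp [hte, ht]
  let π : FreeInvolutions A →* Equiv.Perm (FreeGroup {a // a ≠ o}) :=
    lift (fun a => (hinv a).toPerm) fun a =>
    Equiv.ext (hinv a)
  have key : π.comp (evenHom o) = MulAction.toPermHom _ _ := by
    ext a u
    have ho : e o = 1 := by simp [e]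
    have ha : e a = FreeGroup.of a := by simp [e, a.2]
    simp [π, evenHom, ho, ha, ht]
  refine Function.Injective.of_comp (f := π) ?_
  rw [← MonoidHom.coe_comp, key]
  exact MulAction.toPerm_injective

/-- The permutation `(u, v) ↦ (a * s v, u)` of the square of the group. -/
def twistedSwap {s : A → A} (hs : Function.Involutive s) (a : A) :
    Equiv.Perm (FreeInvolutions A × FreeInvolutions A) where
  toFun p := (of a * map s p.2, p.1)
  invFun p := (p.2, map s (of a * p.1))
  left_inv p := by simp [of_mul_cancel_left, map_map hs, -map_mul]
  right_inv p := by simp [of_mul_cancel_left, map_map hs, -map_mul]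

/-- Each coordinate is hit twice: one by `s a` then `a`, the other by `s b` then `b`. The twist by
`s` in between turns both pairs into the square of an involution. -/
theorem twistedSwap_relation {s : A → A} (hs : Function.Involutive s) (a b : A) :
    twistedSwap hs a * twistedSwap hs b * twistedSwap hs (s a) * twistedSwap hs (s b) = 1 := by
  ext p <;> simp [twistedSwap, hs a, hs b, map_map hs, of_mul_cancel_left]

end FreeInvolutions

/-! ### Groups with relations `y a * y b * y (s a) * y (s b) = 1`. -/

namespace SquareGroup

variable {A G : Type*} [Group G] {y : A → G} {s : A → A}

theorem conj_eq_inv_mul (hy : ∀ a b, y a * y b * y (s a) * y (s b) = 1) (o b : A) :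
    y o * y b * (y o)⁻¹ * (y o)⁻¹ = (y (s b))⁻¹ * y (s o) := by
  have h₁ : y o * y b = (y (s b))⁻¹ * (y (s o))⁻¹ := by
    rw [← mul_inv_rev, ← mul_eq_one_iff_eq_inv, ← mul_assoc, hy]
  have h₂ : y o * y o = (y (s o))⁻¹ * (y (s o))⁻¹ := by
    rw [← mul_inv_rev, ← mul_eq_one_iff_eq_inv, ← mul_assoc, hy]
  rw [mul_assoc _ (y o)⁻¹, ← mul_inv_rev, h₁, h₂]
  group

/-- Conjugating `y a * (y o)⁻¹` by `y (s c)` gives a result independent of `c` (`key`). Comparing `c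
= b` with `c = o`, the element `(y (s b))⁻¹ * y (s o)` centralises it, and this is the second
element by `conj_eq_inv_mul`. -/
theorem commute_mul_inv (hy : ∀ a b, y a * y b * y (s a) * y (s b) = 1) (o a b : A) :
    Commute (y a * (y o)⁻¹) (y o * y b * (y o)⁻¹ * (y o)⁻¹) := by
  have key : ∀ c, y (s c) * (y a * (y o)⁻¹) * (y (s c))⁻¹ = (y (s a))⁻¹ * y (s o) := by
    intro c
    have h : ∀ d, y d = (y (s c))⁻¹ * (y (s d))⁻¹ * (y c)⁻¹ := by
      intro d
      rw [eq_mul_inv_iff_mul_eq, ← mul_inv_rev, ← mul_eq_one_iff_eq_inv, ← mul_assoc, hy]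
    rw [h a, h o]
    group
  rw [conj_eq_inv_mul hy]
  have h := (key b).trans (key o).symm
  rw [mul_inv_eq_iff_eq_mul] at h
  change _ * _ = _ * _
  rw [mul_assoc (y (s b))⁻¹, eq_inv_mul_iff_mul_eq, ← mul_assoc, h]
  group

/-- The homomorphism from a free group that sends the generator `a ≠ o` to `y a * (y o)⁻¹`. -/
def quotientHom (y : A → G) (o : A) : FreeGroup {a // a ≠ o} →* G :=
  FreeGroup.lift fun a => y a * (y o)⁻¹

/-- The homomorphism from a free group that sends the generator `b ≠ o` to the conjugate of
`y b * (y o)⁻¹` by `y o`. -/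
def conjQuotientHom (y : A → G) (o : A) : FreeGroup {a // a ≠ o} →* G :=
  FreeGroup.lift fun b => y o * y b * (y o)⁻¹ * (y o)⁻¹

theorem mem_range_quotientHom (y : A → G) (o a : A) :
    y a * (y o)⁻¹ ∈ (quotientHom y o).range := by
  by_cases h : a = o
  · rw [h, mul_inv_cancel]
    exact one_mem _
  · exact ⟨FreeGroup.of ⟨a, h⟩, by simp [quotientHom]⟩

theorem mem_range_conjQuotientHom (y : A → G) (o b : A) :
    y o * y b * (y o)⁻¹ * (y o)⁻¹ ∈ (conjQuotientHom y o).range := by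
  by_cases h : b = o
  · rw [h, mul_inv_cancel_right, mul_inv_cancel]
    exact one_mem _
  · exact ⟨FreeGroup.of ⟨b, h⟩, by simp [conjQuotientHom]⟩

theorem _root_.FreeGroup.commute_lift {α β : Type*} {f : α → G} {g : β → G}
    (h : ∀ a b, Commute (f a) (g b)) (u : FreeGroup α) (v : FreeGroup β) :
    Commute (FreeGroup.lift f u) (FreeGroup.lift g v) := by
  have h₁ : ∀ a, Commute (f a) (FreeGroup.lift g v) := by
    intro a
    induction v using FreeGroup.induction_on with
    | C1 => simp
    | of b => simpa using h a b
    | inv_of b hb => simpa using hb.inv_right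
    | mul v w hv hw => simpa using hv.mul_right hw
  induction u using FreeGroup.induction_on with
  | C1 => simp
  | of b => simpa using h₁ b
  | inv_of b hb => simpa using hb.inv_left
  | mul v w hv hw => simpa using hv.mul_left hw

/-- The homomorphism from the product of two free groups given by `quotientHom` and
`conjQuotientHom`. -/
def prodHom (hy : ∀ a b, y a * y b * y (s a) * y (s b) = 1) (o : A) :
    FreeGroup {a // a ≠ o} × FreeGroup {a // a ≠ o} →* G :=
  (quotientHom y o).noncommCoprod (conjQuotientHom y o) <|
    FreeGroup.commute_lift fun a b => commute_mul_inv hy o a b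

theorem range_prodHom (hy : ∀ a b, y a * y b * y (s a) * y (s b) = 1) (o : A) :
    (prodHom hy o).range = (quotientHom y o).range ⊔ (conjQuotientHom y o).range :=
  MonoidHom.noncommCoprod_range _ _ _

/-- Under `ρ` each factor becomes left translation of one coordinate through `evenHom`, so the image
of `(1, 1)` determines both components. -/
theorem prodHom_injective (hs : Function.Involutive s)
    (hy : ∀ a b, y a * y b * y (s a) * y (s b) = 1) (o : A)
    (ρ : G →* Equiv.Perm (FreeInvolutions A × FreeInvolutions A))
    (hρ : ∀ a, ρ (y a) = FreeInvolutions.twistedSwap hs a) :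
    Function.Injective (prodHom hy o) := by
  have hoo := FreeInvolutions.of_mul_cancel_left o
  have hinv : ∀ p : FreeInvolutions A × FreeInvolutions A,
      (FreeInvolutions.twistedSwap hs o).symm p
        = (p.2, FreeInvolutions.map s (FreeInvolutions.of o * p.1)) := fun _ => rfl
  have hswap : ∀ a (p : FreeInvolutions A × FreeInvolutions A),
      FreeInvolutions.twistedSwap hs a p
        = (FreeInvolutions.of a * FreeInvolutions.map s p.2, p.1) := fun _ _ => rfl
  have h₁ : ∀ f p, ρ (quotientHom y o f) p = (FreeInvolutions.evenHom o f * p.1, p.2) := by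
    intro f
    induction f using FreeGroup.induction_on with
    | C1 => simp
    | of a =>
      intro p
      simp [quotientHom, FreeInvolutions.evenHom, hρ, hinv, hswap,
        FreeInvolutions.map_map hs, -_root_.map_mul, map_mul ρ, mul_assoc]
    | inv_of a ha =>
      intro p
      rw [map_inv, map_inv, map_inv, Equiv.Perm.inv_eq_iff_eq, ha]
      simp
    | mul f g hf hg => intro p; simp [hf, hg, mul_assoc]
  have h₂ : ∀ f p, ρ (conjQuotientHom y o f) p = (p.1, FreeInvolutions.evenHom o f * p.2) := by
    intro f
    induction f using FreeGroup.induction_on with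
    | C1 => simp
    | of a =>
      intro p
      simp [conjQuotientHom, FreeInvolutions.evenHom, hρ, hinv, hswap,
        FreeInvolutions.map_map hs, -_root_.map_mul, map_mul ρ, mul_assoc, hoo]
    | inv_of a ha =>
      intro p
      rw [map_inv, map_inv, map_inv, Equiv.Perm.inv_eq_iff_eq, ha]
      simp
    | mul f g hf hg => intro p; simp [hf, hg, mul_assoc]
  refine (injective_iff_map_eq_one _).2 fun ⟨f, g⟩ hfg => ?_
  have h : ρ (prodHom hy o (f, g)) 1
      = (FreeInvolutions.evenHom o f, FreeInvolutions.evenHom o g) := by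
    change ρ (quotientHom y o f * conjQuotientHom y o g) 1 = _
    simp [h₁, h₂]
  rw [hfg, MonoidHom.map_one] at h
  have hf : FreeInvolutions.evenHom o f = 1 := (congrArg Prod.fst h).symm
  have hg : FreeInvolutions.evenHom o g = 1 := (congrArg Prod.snd h).symm
  exact Prod.ext ((injective_iff_map_eq_one _).1 (FreeInvolutions.evenHom_injective o) f hf)
    ((injective_iff_map_eq_one _).1 (FreeInvolutions.evenHom_injective o) g hg)

/-- Conjugation by `y o` exchanges the two factors, and every `y a` lies in the coset of `y o`, so
normalisation by `y o` suffices. -/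
theorem range_prodHom_normal (hs : Function.Involutive s)
    (hy : ∀ a b, y a * y b * y (s a) * y (s b) = 1) (o : A)
    (hgen : Subgroup.closure (Set.range y) = ⊤) : (prodHom hy o).range.Normal := by
  set N := (prodHom hy o).range with hN
  have hq : ∀ a, y a * (y o)⁻¹ ∈ N := fun a => by
    rw [hN, range_prodHom]
    exact Subgroup.mem_sup_left (mem_range_quotientHom y o a)
  have hc : ∀ a, y o * y a * (y o)⁻¹ * (y o)⁻¹ ∈ N := fun a => by
    rw [hN, range_prodHom]
    exact Subgroup.mem_sup_right (mem_range_conjQuotientHom y o a)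
  have conj_le : ∀ g : G, (∀ a, g * (y a * (y o)⁻¹) * g⁻¹ ∈ N) →
      (∀ a, g * (y o * y a * (y o)⁻¹ * (y o)⁻¹) * g⁻¹ ∈ N) →
      N ≤ N.comap (MulAut.conj g).toMonoidHom := by
    intro g h₁ h₂
    conv_lhs => rw [hN, range_prodHom]
    rw [quotientHom, conjQuotientHom, FreeGroup.range_lift_eq_closure,
      FreeGroup.range_lift_eq_closure, sup_le_iff, Subgroup.closure_le, Subgroup.closure_le]
    exact ⟨by rintro _ ⟨a, rfl⟩; exact h₁ a, by rintro _ ⟨a, rfl⟩; exact h₂ a⟩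
  have ho : N ≤ N.comap (MulAut.conj (y o)).toMonoidHom := by
    refine conj_le _ (fun a => ?_) fun a => ?_
    · simpa only [mul_assoc] using hc a
    · rw [conj_eq_inv_mul hy]
      convert N.mul_mem (N.inv_mem (hq (s a))) (hq (s o)) using 1
      group
  have ho' : N ≤ N.comap (MulAut.conj (y o)⁻¹).toMonoidHom := by
    refine conj_le _ (fun a => ?_) fun a => ?_
    -- The conjugate is `(y o)⁻¹ * y a`, which telescopes through `y (s o)`.
    · have h := N.mul_mem (hc (s o)) (N.inv_mem (hc (s a)))
      rw [conj_eq_inv_mul hy, conj_eq_inv_mul hy, hs, hs] at h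
      convert h using 1
      group
    · convert hq a using 1
      group
  have hno : y o ∈ Subgroup.normalizer (N : Set G) := by
    refine Subgroup.mem_normalizer_iff.2 fun n => ⟨fun hn => ho hn, fun hn => ?_⟩
    have := ho' hn
    simpa [mul_assoc] using this
  rw [← Subgroup.normalizer_eq_top_iff, eq_top_iff, ← hgen, Subgroup.closure_le]
  rintro _ ⟨a, rfl⟩
  have := mul_mem (Subgroup.le_normalizer (hq a)) hno
  rwa [inv_mul_cancel_right] at this

/-- Modulo the normal subgroup `N` every generator equals `y o`, and `y o ^ 4 ∈ N`. So the quotient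
is cyclic of order dividing 4, and the degree detects it. -/
theorem range_prodHom_eq_ker (hs : Function.Involutive s)
    (hy : ∀ a b, y a * y b * y (s a) * y (s b) = 1) (o : A)
    (hgen : Subgroup.closure (Set.range y) = ⊤) (deg : G →* Multiplicative (ZMod 4))
    (hdeg : ∀ a, deg (y a) = Multiplicative.ofAdd 1) : (prodHom hy o).range = deg.ker := by
  have hN := range_prodHom_normal hs hy o hgen
  set N := (prodHom hy o).range with hNdef
  have hq : ∀ a, y a * (y o)⁻¹ ∈ N := fun a => by
    rw [hNdef, range_prodHom]
    exact Subgroup.mem_sup_left (mem_range_quotientHom y o a)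
  have hc : ∀ a, y o * y a * (y o)⁻¹ * (y o)⁻¹ ∈ N := fun a => by
    rw [hNdef, range_prodHom]
    exact Subgroup.mem_sup_right (mem_range_conjQuotientHom y o a)
  have hle : N ≤ deg.ker := by
    rw [hNdef, range_prodHom, quotientHom, conjQuotientHom, FreeGroup.range_lift_eq_closure,
      FreeGroup.range_lift_eq_closure, sup_le_iff, Subgroup.closure_le, Subgroup.closure_le]
    exact ⟨by rintro _ ⟨a, rfl⟩; simp [hdeg], by rintro _ ⟨a, rfl⟩; simp [hdeg]⟩
  have hpow : y o ^ 4 ∈ N := by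
    -- The product is `y (s o) ^ 2 * (y o)⁻¹ ^ 2`, and `y (s o) ^ 2 = (y o)⁻¹ ^ 2` by the relation
    -- for `(o, o)`.
    have h := N.inv_mem (N.mul_mem (hq (s o)) (hc (s o)))
    convert h using 1
    have h₂ : y o * y o = (y (s o))⁻¹ * (y (s o))⁻¹ := by
      rw [← mul_inv_rev, ← mul_eq_one_iff_eq_inv, ← mul_assoc, hy]
    calc y o ^ 4 = y o * y o * (y o * y o) := by simp only [pow_succ, pow_zero, one_mul, mul_assoc]
      _ = y o * y o * ((y (s o))⁻¹ * (y (s o))⁻¹) := by rw [← h₂]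
      _ = _ := by simp only [mul_inv_rev, inv_inv, mul_assoc, inv_mul_cancel_left]
  have htop : N ⊔ Subgroup.zpowers (y o) = ⊤ := by
    rw [eq_top_iff, ← hgen, Subgroup.closure_le]
    rintro _ ⟨a, rfl⟩
    have := mul_mem (Subgroup.mem_sup_left (hq a) : _ ∈ N ⊔ Subgroup.zpowers (y o))
      (Subgroup.mem_sup_right (Subgroup.mem_zpowers (y o)))
    rwa [inv_mul_cancel_right] at this
  refine le_antisymm hle fun g hg => ?_
  obtain ⟨n, hn, _, ⟨k, rfl⟩, rfl⟩ := Subgroup.mem_sup_of_normal_left.1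
    (htop ▸ Subgroup.mem_top g : g ∈ N ⊔ Subgroup.zpowers (y o))
  have hk : deg (y o ^ k) = 1 := by
    have h := MonoidHom.mem_ker.1 hg
    rw [map_mul, MonoidHom.mem_ker.1 (hle hn), one_mul] at h
    exact h
  have hk' : ((k : ℤ) : ZMod 4) = 0 := by
    rw [map_zpow, hdeg, ← ofAdd_zsmul, ofAdd_eq_one] at hk
    simpa using hk
  obtain ⟨m, rfl⟩ := (ZMod.intCast_zmod_eq_zero_iff_dvd k 4).1 hk'
  refine mul_mem hn ?_
  change y o ^ ((4 : ℤ) * m) ∈ N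
  rw [zpow_mul]
  exact zpow_mem (by exact_mod_cast hpow) m

theorem index_ker_eq_four {y : G} (deg : G →* Multiplicative (ZMod 4))
    (hdeg : deg y = Multiplicative.ofAdd 1) : deg.ker.index = 4 := by
  have hsurj : Function.Surjective deg := by
    intro n
    refine ⟨y ^ (n.toAdd.val), ?_⟩
    rw [map_pow, hdeg, ← ofAdd_nsmul]
    simp
  rw [Subgroup.index_ker, MonoidHom.range_eq_top.2 hsurj, Subgroup.card_top,
    Nat.card_congr Multiplicative.toAdd, Nat.card_zmod]

/-! ### The group Γ and its degree map. -/

/-- The index `1 + 4i, 2 + 4i, 3 + 4i, 4 + 4i` opposite to a given one in every relator: it is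
`4 + 4i, 3 + 4i, 2 + 4i, 1 + 4i` respectively. -/
def opposite {q : ℕ} (a : Set.Icc 1 (4 * q)) : Set.Icc 1 (4 * q) :=
  -- With `i = (a - 1) / 4`, opposite indices sum to `8i + 5`.
  ⟨8 * ((a - 1) / 4) + 5 - a, by have := a.2.1; have := a.2.2; constructor <;> omega⟩

theorem opposite_involutive {q : ℕ} : Function.Involutive (opposite (q := q)) := by
  rintro ⟨a, ha₁, ha₂⟩
  ext
  simp only [opposite]
  omega

theorem exists_eq_add_four_mul {q : ℕ} (a : Set.Icc 1 (4 * q)) :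
    ∃ i : Fin q, (a : ℕ) = 1 + 4 * i ∨ (a : ℕ) = 2 + 4 * i ∨ (a : ℕ) = 3 + 4 * i ∨
      (a : ℕ) = 4 + 4 * i := by
  have h₁ := a.2.1
  have h₂ := a.2.2
  exact ⟨⟨((a : ℕ) - 1) / 4, by omega⟩, by simp only; omega⟩

/-- The image of `x k` in `Gamma q`, or `1` if there is no such generator. -/
def letter (q k : ℕ) : Gamma q :=
  if hk : k ∈ Set.Icc 1 (4 * q) then PresentedGroup.of ⟨k, hk⟩ else 1

/-- Indexing by plain naturals allows rewriting the index without carrying membership proofs. -/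
theorem of_eq_letter {q : ℕ} (a : Set.Icc 1 (4 * q)) :
    (PresentedGroup.of a : Gamma q) = letter q a := by
  simp only [letter, Subtype.coe_prop, dif_pos]

theorem letter_mul_eq_one {q a b c d : ℕ} (ha : a ∈ Set.Icc 1 (4 * q))
    (hb : b ∈ Set.Icc 1 (4 * q)) (hc : c ∈ Set.Icc 1 (4 * q)) (hd : d ∈ Set.Icc 1 (4 * q))
    (h : x a ha * x b hb * x c hc * x d hd ∈ relators q) :
    letter q a * letter q b * letter q c * letter q d = 1 := by
  simp only [letter, ha, hb, hc, hd, dif_pos]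
  exact PresentedGroup.one_of_mem h

theorem mul_rotate_eq_one {a b c d : G} (h : a * b * c * d = 1) : b * c * d * a = 1 :=
  mul_eq_one_comm.1 (by simpa only [mul_assoc] using h)

/-- Rotating a relator sends `(a, b)` to `(b, ā)`. The sixteen pairs of positions within the blocks
of four split into four orbits of size four, one for each family of relators; odd rotations exchange
`i` and `j`. -/
theorem of_mul_of_mul_of_opposite {q : ℕ} (a b : Set.Icc 1 (4 * q)) :
    (PresentedGroup.of a * PresentedGroup.of b * PresentedGroup.of (opposite a) *
      PresentedGroup.of (opposite b) : Gamma q) = 1 := by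
  have h₁ : ∀ i j : Fin q, letter q (1 + 4 * i) * letter q (2 + 4 * j) * letter q (4 + 4 * i) *
      letter q (3 + 4 * j) = 1 :=
    fun i j => letter_mul_eq_one _ _ _ _ ⟨i, j, Or.inl rfl⟩
  have h₂ : ∀ i j : Fin q, letter q (1 + 4 * i) * letter q (1 + 4 * j) * letter q (4 + 4 * i) *
      letter q (4 + 4 * j) = 1 :=
    fun i j => letter_mul_eq_one _ _ _ _ ⟨i, j, Or.inr (Or.inl rfl)⟩
  have h₃ : ∀ i j : Fin q, letter q (1 + 4 * i) * letter q (3 + 4 * j) * letter q (4 + 4 * i) *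
      letter q (2 + 4 * j) = 1 :=
    fun i j => letter_mul_eq_one _ _ _ _ ⟨i, j, Or.inr (Or.inr (Or.inl rfl))⟩
  have h₄ : ∀ i j : Fin q, letter q (2 + 4 * i) * letter q (2 + 4 * j) * letter q (3 + 4 * i) *
      letter q (3 + 4 * j) = 1 :=
    fun i j => letter_mul_eq_one _ _ _ _ ⟨i, j, Or.inr (Or.inr (Or.inr rfl))⟩
  have hopp : ∀ c : Set.Icc 1 (4 * q), ∀ k m : ℕ, (c : ℕ) = k + 4 * m → 1 ≤ k → k ≤ 4 →
      (opposite c : ℕ) = (5 - k) + 4 * m := by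
    intro c k m hc hk hk'
    simp only [opposite, hc]
    omega
  obtain ⟨i, ha⟩ := exists_eq_add_four_mul a
  obtain ⟨j, hb⟩ := exists_eq_add_four_mul b
  simp only [of_eq_letter]
  rcases ha with ha | ha | ha | ha <;> rcases hb with hb | hb | hb | hb <;>
    rw [hopp a _ _ ha (by norm_num) (by norm_num), hopp b _ _ hb (by norm_num) (by norm_num),
      ha, hb]
  · exact h₂ i j
  · exact h₁ i j
  · exact h₃ i j
  · exact mul_rotate_eq_one (h₂ j i)
  · exact mul_rotate_eq_one (mul_rotate_eq_one (mul_rotate_eq_one (h₃ j i)))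
  · exact h₄ i j
  · exact mul_rotate_eq_one (h₄ j i)
  · exact mul_rotate_eq_one (h₁ j i)
  · exact mul_rotate_eq_one (mul_rotate_eq_one (mul_rotate_eq_one (h₁ j i)))
  · exact mul_rotate_eq_one (mul_rotate_eq_one (mul_rotate_eq_one (h₄ j i)))
  · exact mul_rotate_eq_one (mul_rotate_eq_one (h₄ i j))
  · exact mul_rotate_eq_one (h₃ j i)
  · exact mul_rotate_eq_one (mul_rotate_eq_one (mul_rotate_eq_one (h₂ j i)))
  · exact mul_rotate_eq_one (mul_rotate_eq_one (h₃ i j))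
  · exact mul_rotate_eq_one (mul_rotate_eq_one (h₁ i j))
  · exact mul_rotate_eq_one (mul_rotate_eq_one (h₂ i j))

/-- A map on the generators that satisfies the relations `f a * f b * f ā * f b̄ = 1`, with `ā`
the index opposite to `a`, extends to `Gamma q`. -/
def lift {q : ℕ} (f : Set.Icc 1 (4 * q) → G)
    (hf : ∀ a b, f a * f b * f (opposite a) * f (opposite b) = 1) : Gamma q →* G :=
  PresentedGroup.toGroup (f := f) <| by
    have key : ∀ (a b c d : ℕ) (ha : a ∈ Set.Icc 1 (4 * q)) (hb : b ∈ Set.Icc 1 (4 * q))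
        (hc : c ∈ Set.Icc 1 (4 * q)) (hd : d ∈ Set.Icc 1 (4 * q)),
        opposite ⟨a, ha⟩ = ⟨c, hc⟩ → opposite ⟨b, hb⟩ = ⟨d, hd⟩ →
        FreeGroup.lift f (x a ha * x b hb * x c hc * x d hd) = 1 := by
      intro a b c d ha hb hc hd hac hbd
      simp only [x, map_mul, FreeGroup.lift_apply_of, ← hac, ← hbd, hf]
    rintro _ ⟨i, j, rfl | rfl | rfl | rfl⟩ <;> apply key <;>
      · refine Subtype.ext ?_
        simp only [opposite]
        omega

@[simp]
theorem lift_of {q : ℕ} (f : Set.Icc 1 (4 * q) → G)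
    (hf : ∀ a b, f a * f b * f (opposite a) * f (opposite b) = 1) (a : Set.Icc 1 (4 * q)) :
    lift f hf (PresentedGroup.of a) = f a :=
  PresentedGroup.toGroup.of _

/-- The homomorphism to `ℤ / 4` that sends every generator to `1`. -/
def degree (q : ℕ) : Gamma q →* Multiplicative (ZMod 4) :=
  lift (fun _ => Multiplicative.ofAdd 1) fun _ _ => by decide

theorem degree_of {q : ℕ} (a : Set.Icc 1 (4 * q)) :
    degree q (PresentedGroup.of a) = Multiplicative.ofAdd 1 :=
  lift_of _ _ a

/-- The kernel of `degree` is a product of two free groups of rank `4q - 1`. -/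
noncomputable def kerDegreeEquiv {q : ℕ} (o : Set.Icc 1 (4 * q)) :
    (degree q).ker ≃* FreeGroup {a // a ≠ o} × FreeGroup {a // a ≠ o} :=
  ((MonoidHom.ofInjective (prodHom_injective opposite_involutive of_mul_of_mul_of_opposite o
      (lift _ (FreeInvolutions.twistedSwap_relation opposite_involutive)) (lift_of _ _))).trans
    (MulEquiv.subgroupCongr (range_prodHom_eq_ker opposite_involutive of_mul_of_mul_of_opposite o
      (PresentedGroup.closure_range_of _) (degree q) degree_of))).symm

end SquareGroup

theorem lemma5p5 (q : ℕ) (hq : 1 ≤ q) :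
    ∃ Γ₀ : Subgroup (SquareGroup.Gamma q), Γ₀.index = 4 ∧
      BurgerMozes.IsOfBMType Γ₀ (2 * (4 * q - 1)) (2 * (4 * q - 1)) := by
  let o : Set.Icc 1 (4 * q) := ⟨1, by constructor <;> omega⟩
  refine ⟨(SquareGroup.degree q).ker,
    SquareGroup.index_ker_eq_four _ (SquareGroup.degree_of o), ?_⟩
  have hcard : Fintype.card {a // a ≠ o} = 4 * q - 1 := by
    rw [Fintype.card_subtype_compl, Fintype.card_subtype_eq]
    simp
  rw [← hcard]
  exact BurgerMozes.isOfBMType_of_mulEquiv (SquareGroup.kerDegreeEquiv o)
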